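/- **Language.** Let $\Phi$ be an infinite set of propositions. Formulas of $\mathcal{ONL}_n$ (two agents $a,b$) are built from $\Phi$ with $\neg,\vee$ and the modal operators $\mathbf L_i,\mathbf N_i$, $i\in\{a,b\}$; $\supset,\wedge$ are the usual abbreviations, and $\Box_i$ stands for $\mathbf L_i$ or $\mathbf N_i$. The $i$-depth is given by $|p|_i=1$, $|\neg\alpha|_i=|\alpha|_i$, $|\alpha\vee\beta|_i=\max(|\alpha|_i,|\beta|_i)$, $|\Box_i\alpha|_i=|\alpha|_i$, and $|\Box_j\alpha|_i=|\alpha|_j+1$ for $j\ne i$. A formula is *basic* if it contains no $\mathbf N_a,\mathbf N_b$. It is *$i$-objective* if every modal operator not in the scope of another one belongs to the agent $j\neq i$; it is *$i$-subjective* if every atom is in the scope of a modal operator and every modal operator not in the scope of another one belongs to $i$. $\mathcal{ONL}_n^1=\mathcal{ONL}_n^-$ is the set of formulas in which no $\mathbf N_j$ occurs in the scope of an $\mathbf L_i$ or $\mathbf N_i$ with $i\neq j$; $\mathcal{ONL}_n^{t+1}$ consists of all Boolean combinations of formulas of $\mathcal{ONL}_n^t$ and formulas $\mathbf L_i\alpha$,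 $\mathbf N_i\alpha$ with $\alpha\in\mathcal{ONL}_n^t$. **Semantics.** A world is a subset of $\Phi$; $\mathcal W$ is the set of all worlds. Put $\mathbb E^0=\{\{\}\}$ (a single trivial structure), and for $k\ge 1$ let the set of $k$-structures be $\mathbb E^k=\mathcal P(\mathcal W\times\mathbb E^{k-1})$. A $(k,j)$-model is a triple $(e_a,e_b,w)\in\mathbb E^k\times\mathbb E^j\times\mathcal W$. Truth of formulas of $a$-depth at most $k$ and $b$-depth at most $j$ is classical for $p$ (true iff $p\in w$), $\neg$, $\vee$, and - $e_a,e_b,w\models\mathbf L_a\alpha$ iff $e_a,e_b',w'\models\alpha$ for all $\langle w',e_b'\rangle\in e_a$, where $e_b'\in\mathbb E^{k-1}$; - $e_a,e_b,w\models\mathbf N_a\alpha$ iff $e_a,e_b',w'\models\alpha$ for all $\langle w',e_b'\rangle\in(\mathcal W\times\mathbb E^{k-1})\setminus e_a$; and symmetrically for $b$. A formula $\alpha$ with $|\alpha|_a=k$ and $|\alpha|_b=j$ is *valid*, $\models\alpha$, if it is true at all $(k,j)$-models. **Axioms.** For $t\geq1$, $AX_n^t$ has the rules modus ponens and necessitation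 (from $\alpha$ infer $\mathbf L_i\alpha$ and $\mathbf N_i\alpha$) and, over all formulas of $\mathcal{ONL}_n$, the axioms - $\mathbf{A1}_n$: all instances of propositional tautologies; - $\mathbf{A2}_n$: $\mathbf L_i(\alpha\supset\beta)\supset(\mathbf L_i\alpha\supset\mathbf L_i\beta)$; - $\mathbf{A3}_n$: $\mathbf N_i(\alpha\supset\beta)\supset(\mathbf N_i\alpha\supset\mathbf N_i\beta)$; - $\mathbf{A4}_n$: $\sigma\supset\mathbf L_i\sigma\wedge\mathbf N_i\sigma$ for $i$-subjective $\sigma$; - $\mathbf{A5}_n^1$: $\mathbf N_i\alpha\supset\neg\mathbf L_i\alpha$ if $\neg\alpha$ is basic, $i$-objective and consistent in the modal logic $\mathsf{K45}_n$ (with modalities $\mathbf L_a,\mathbf L_b$); - $\mathbf{A5}_n^{s+1}$ for $1\le s<t$: $\mathbf N_i\alpha\supset\neg\mathbf L_i\alpha$ if $\neg\alpha\in\mathcal{ONL}_n^s$ is $i$-objective and consistent with respect to $AX_n^s$. A formula $\varphi$ is called consistent with respect to a proof system if $\neg\varphi$ is not provable in it. **Theorem.** For every $t\geq 1$ and every $\alpha\in\mathcal{ONL}_n^t$: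 if $\models\alpha$, then $AX_n^t\vdash\alpha$. -/

import Mathlib

universe u

namespace OnlyKnowing

/-- The two agents, Alice and Bob. -/
inductive Agent : Type
  | a
  | b
  deriving DecidableEq

/-- The agent different from the given one. -/
def Agent.other : Agent → Agent
  | .a => .b
  | .b => .a

/-- Formulas of the propositional multi-agent logic of only-knowing over the propositions `Φ`:
`L i α` is "at least `α` is known by `i`", `N i α` is "at most `¬ α` is known by `i`". -/
inductive Formula (Φ : Type u) : Type u
  | atom : Φ → Formula Φ
  | neg : Formula Φ → Formula Φ
  | disj : Formula Φ → Formula Φ → Formula Φ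
  | L : Agent → Formula Φ → Formula Φ
  | N : Agent → Formula Φ → Formula Φ

variable {Φ : Type u}

namespace Formula

/-- Material implication, as the usual abbreviation. -/
def imp (α β : Formula Φ) : Formula Φ := disj (neg α) β

/-- Conjunction, as the usual abbreviation. -/
def conj (α β : Formula Φ) : Formula Φ := neg (disj (neg α) (neg β))

/-- The `i`-depth of a formula. -/
def depth : Formula Φ → Agent → ℕ
  | atom _, _ => 1
  | neg α, i => α.depth i
  | disj α β, i => max (α.depth i) (β.depth i)
  | L j α, i => if j = i then α.depth i else α.depth j + 1
  | N j α, i => if j = i then α.depth i else α.depth j + 1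

/-- `i`-objective: every epistemic operator that is not in the scope of another one belongs to
the other agent. -/
def Objective (i : Agent) : Formula Φ → Prop
  | atom _ => True
  | neg α => α.Objective i
  | disj α β => α.Objective i ∧ β.Objective i
  | L j _ => j ≠ i
  | N j _ => j ≠ i

/-- `i`-subjective: every atom is in the scope of an epistemic operator, and every epistemic
operator that is not in the scope of another one belongs to `i`. -/
def Subjective (i : Agent) : Formula Φ → Prop
  | atom _ => False
  | neg α => α.Subjective i
  | disj α β => α.Subjective i ∧ β.Subjective i
  | L j _ => j = i
  | N j _ => j = i

/-- The operator `N j` does not occur in the formula. -/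
def NFree (j : Agent) : Formula Φ → Prop
  | atom _ => True
  | neg α => α.NFree j
  | disj α β => α.NFree j ∧ β.NFree j
  | L _ α => α.NFree j
  | N i α => i ≠ j ∧ α.NFree j

/-- Basic formulas: no operator `N i` occurs, for either agent. -/
def Basic (α : Formula Φ) : Prop := ∀ i, α.NFree i

/-- The language `ONL⁻`: no `N j` occurs in the scope of an `L i` or an `N i` with `i ≠ j`. -/
def InONLMinus : Formula Φ → Prop
  | atom _ => True
  | neg α => α.InONLMinus
  | disj α β => α.InONLMinus ∧ β.InONLMinus
  | L i α => α.InONLMinus ∧ α.NFree i.other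
  | N i α => α.InONLMinus ∧ α.NFree i.other

/-- Truth of a formula under a truth assignment to its atoms and to its subformulas that begin
with an epistemic operator. -/
def PropEval (v : Formula Φ → Prop) : Formula Φ → Prop
  | neg α => ¬ α.PropEval v
  | disj α β => α.PropEval v ∨ β.PropEval v
  | atom p => v (atom p)
  | L i α => v (L i α)
  | N i α => v (N i α)

/-- Substitution instances of propositional tautologies. -/
def Tautology (α : Formula Φ) : Prop := ∀ v : Formula Φ → Prop, α.PropEval v

end Formula

open Formula

/-- Boolean combinations of the formulas in `S`. -/
inductive BoolComb (S : Set (Formula Φ)) : Formula Φ → Prop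
  | base {α : Formula Φ} : α ∈ S → BoolComb S α
  | neg {α : Formula Φ} : BoolComb S α → BoolComb S (neg α)
  | disj {α β : Formula Φ} : BoolComb S α → BoolComb S β → BoolComb S (disj α β)

/-- The languages `ONL¹ = ONL⁻`, `ONL²`, `ONL³`, …; the index `0` is not used. -/
def ONL (Φ : Type u) : ℕ → Set (Formula Φ)
  | 0 => ∅
  | 1 => {α | α.InONLMinus}
  | t + 2 => {φ | BoolComb
      (ONL Φ (t + 1) ∪ {β | ∃ i, ∃ α ∈ ONL Φ (t + 1), β = L i α ∨ β = N i α}) φ}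

/-! ### Semantics -/

/-- `k`-structures. A world is a set of propositions. For `k ≥ 1`, a `k`-structure is a set of
pairs of a world and a `(k-1)`-structure (for the other agent), where the only `0`-structure is
the trivial one, so that a `1`-structure amounts to a set of worlds. -/
def KStruct (Φ : Type u) : ℕ → Type u
  | 0 => PUnit
  | k + 1 => Set (Set Φ × KStruct Φ k)

/-- The elements of a `(k+1)`-structure. -/
def KStruct.Mem {k : ℕ} (e : KStruct Φ (k + 1)) (w : Set Φ) (e' : KStruct Φ k) : Prop :=
  (w, e') ∈ (show Set (Set Φ × KStruct Φ k) from e)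

/-- Truth of a formula at `(e_a, e_b, w)`, where `e_a` is a `k`-structure for Alice, `e_b` a
`j`-structure for Bob, and `w` a world. The operators of an agent whose structure is the trivial
`0`-structure get a dummy value; this case is never reached when a formula of `a`-depth at most
`k` and `b`-depth at most `j` is evaluated. -/
def Sat : Formula Φ → (k j : ℕ) → KStruct Φ k → KStruct Φ j → Set Φ → Prop
  | atom p, _, _, _, _, w => p ∈ w
  | neg α, k, j, ea, eb, w => ¬ Sat α k j ea eb w
  | disj α β, k, j, ea, eb, w => Sat α k j ea eb w ∨ Sat β k j ea eb w
  | L .a α, k + 1, _, ea, _, _ =>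
      ∀ (w' : Set Φ) (eb' : KStruct Φ k), ea.Mem w' eb' → Sat α (k + 1) k ea eb' w'
  | N .a α, k + 1, _, ea, _, _ =>
      ∀ (w' : Set Φ) (eb' : KStruct Φ k), ¬ ea.Mem w' eb' → Sat α (k + 1) k ea eb' w'
  | L .b α, _, j + 1, _, eb, _ =>
      ∀ (w' : Set Φ) (ea' : KStruct Φ j), eb.Mem w' ea' → Sat α j (j + 1) ea' eb w'
  | N .b α, _, j + 1, _, eb, _ =>
      ∀ (w' : Set Φ) (ea' : KStruct Φ j), ¬ eb.Mem w' ea' → Sat α j (j + 1) ea' eb w'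
  | L .a _, 0, _, _, _, _ => True
  | N .a _, 0, _, _, _, _ => True
  | L .b _, _, 0, _, _, _ => True
  | N .b _, _, 0, _, _, _ => True

/-- Validity of a formula of `a`-depth `k` and `b`-depth `j`: truth at all `(k,j)`-models. -/
def Valid (α : Formula Φ) : Prop :=
  ∀ (ea : KStruct Φ (α.depth .a)) (eb : KStruct Φ (α.depth .b)) (w : Set Φ),
    Sat α (α.depth .a) (α.depth .b) ea eb w

/-! ### Proof theory -/

/-- Provability in the modal logic `K45` for two agents, over the basic formulas. -/
inductive K45 : Formula Φ → Prop
  | taut {α : Formula Φ} : α.Basic → α.Tautology → K45 α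
  | axK (i : Agent) {α β : Formula Φ} : α.Basic → β.Basic →
      K45 (imp (L i (imp α β)) (imp (L i α) (L i β)))
  | ax4 (i : Agent) {α : Formula Φ} : α.Basic → K45 (imp (L i α) (L i (L i α)))
  | ax5 (i : Agent) {α : Formula Φ} : α.Basic → K45 (imp (neg (L i α)) (L i (neg (L i α))))
  | mp {α β : Formula Φ} : K45 (imp α β) → K45 α → K45 β
  | nec (i : Agent) {α : Formula Φ} : K45 α → K45 (L i α)

/-- Provability from `A1`–`A4` with the rules `MP` and `NEC` (for `L i` and `N i`), together with
the axioms `N i α ⊃ ¬ L i α` for the pairs `(i, α)` such that `A5 i α` holds. -/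
inductive Deriv (A5 : Agent → Formula Φ → Prop) : Formula Φ → Prop
  | a1 {α : Formula Φ} : α.Tautology → Deriv A5 α
  | a2 (i : Agent) (α β : Formula Φ) : Deriv A5 (imp (L i (imp α β)) (imp (L i α) (L i β)))
  | a3 (i : Agent) (α β : Formula Φ) : Deriv A5 (imp (N i (imp α β)) (imp (N i α) (N i β)))
  | a4 (i : Agent) {σ : Formula Φ} : σ.Subjective i → Deriv A5 (imp σ (conj (L i σ) (N i σ)))
  | a5 {i : Agent} {α : Formula Φ} : A5 i α → Deriv A5 (imp (N i α) (neg (L i α)))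
  | mp {α β : Formula Φ} : Deriv A5 (imp α β) → Deriv A5 α → Deriv A5 β
  | necL (i : Agent) {α : Formula Φ} : Deriv A5 α → Deriv A5 (L i α)
  | necN (i : Agent) {α : Formula Φ} : Deriv A5 α → Deriv A5 (N i α)

/-- `A5UpTo t i α`: the formula `N i α ⊃ ¬ L i α` is an instance of one of `A5¹`, …, `A5ᵗ`.
The instances of `A5¹` are those in which `¬ α` is basic, `i`-objective and `K45`-consistent; those
of `A5ᵗ⁺¹` are those in which `¬ α` is an `i`-objective formula of `ONLᵗ` that is consistent with
respect to `A1`–`A4`, `A5¹`, …, `A5ᵗ`. -/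
def A5UpTo : ℕ → Agent → Formula Φ → Prop
  | 0, _, _ => False
  | 1, i, α => (neg α).Basic ∧ (neg α).Objective i ∧ ¬ K45 (neg (neg α))
  | t + 2, i, α => A5UpTo (t + 1) i α ∨
      (neg α ∈ ONL Φ (t + 1) ∧ (neg α).Objective i ∧ ¬ Deriv (A5UpTo (t + 1)) (neg (neg α)))

/-- Provability in the axiom system `AXᵗ`, consisting of `A1`–`A4`, `MP`, `NEC` and `A5¹`, …,
`A5ᵗ`. -/
def AX (t : ℕ) (α : Formula Φ) : Prop := Deriv (A5UpTo t) α

end OnlyKnowing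

/-!
Completeness is proved contrapositively, by building a model of any consistent formula out of
maximal consistent sets. The basic formulas are taken as a level `0` below `ONL¹`; as `K45` and
`A1`–`A4` prove the same basic formulas (`Deriv.eraseN`), all the axioms `A5ˢ` then follow one
pattern (`a5UpTo_succ`), and all levels are treated alike.

Given a maximal consistent set `Γ` for `AXᵗ`, the structure of agent `i` has to consist of pairs
`(w, x)` that are possible for `L i` in `Γ`, and its complement of pairs that are possible for
`N i`, where `(w, x)` is possible if some successor of `Γ` has the same `i`-objective theory, in
the language of level `t - 1` and up to the depth of `x`. Three facts make this work.

* Every pair is possible for `L i` or for `N i` (`possible_L_or_N`). Otherwise some `τ` true at the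
  pair has both `L i (¬ τ)` and `N i (¬ τ)` in `Γ`; since `τ` is satisfiable, soundness of the level
  below makes it consistent, and this contradicts `A5`.
* Pairs possible for both operators have to occur both inside and outside the structure. As `Φ` is
  infinite, there is an atom `q` foreign to the formula under consideration, and such pairs are
  distributed according to the value of `q` (`canonical`).
* A formula missing from `Γ` under `L i` or `N i` is refuted in a successor, which is realized by a
  pair of smaller depth, by induction on the depth (`exists_realizes`).

The truth lemma is `mem_iff_satAt_canonical`. It applies to arbitrary formulas in the scope of an
operator of `i`, not only to objective ones, because successors agree on `i`-subjective formulas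
by `A4`; no normal forms are needed.

Soundness and completeness depend on each other: soundness of `A5` at a level needs completeness at
the lower levels. Derivations pass through formulas of arbitrary depth, so soundness is stated as
truth at all sufficiently large depths (`EventuallySound`). To apply it to a pair of given depth,
the structure is lifted to an equivalent one of larger depth (`exists_sim`), where classes that
meet both a structure and its complement are again split by means of `q`.
-/

namespace OnlyKnowing

open Formula

variable {Φ : Type u}

/-! ### Syntax: agents, fragments, fresh atoms and rank -/

@[simp] lemma Agent.other_other (i : Agent) : i.other.other = i := by cases i <;> rfl

@[simp] lemma Agent.other_ne (i : Agent) : i.other ≠ i := by cases i <;> decide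

@[simp] lemma Agent.ne_other (i : Agent) : i ≠ i.other := by cases i <;> decide

lemma Agent.eq_other_of_ne {i j : Agent} (h : j ≠ i) : j = i.other := by
  cases i <;> cases j <;> simp_all [Agent.other]

lemma Agent.forall_iff (i : Agent) {p : Agent → Prop} : (∀ j, p j) ↔ p i ∧ p i.other := by
  refine ⟨fun h => ⟨h _, h _⟩, fun h j => ?_⟩
  by_cases hj : j = i
  · exact hj ▸ h.1
  · exact Agent.eq_other_of_ne hj ▸ h.2

namespace Formula

@[simp] lemma basic_atom (p : Φ) : (atom p).Basic := fun _ => trivial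

@[simp] lemma basic_neg {α : Formula Φ} : (neg α).Basic ↔ α.Basic := Iff.rfl

@[simp] lemma basic_disj {α β : Formula Φ} : (disj α β).Basic ↔ α.Basic ∧ β.Basic :=
  forall_and

@[simp] lemma basic_L {i : Agent} {α : Formula Φ} : (L i α).Basic ↔ α.Basic := Iff.rfl

@[simp] lemma not_basic_N {i : Agent} {α : Formula Φ} : ¬ (N i α).Basic :=
  fun h => (h i).1 rfl

@[simp] lemma basic_imp {α β : Formula Φ} : (imp α β).Basic ↔ α.Basic ∧ β.Basic := by
  simp [imp]

@[simp] lemma basic_conj {α β : Formula Φ} : (conj α β).Basic ↔ α.Basic ∧ β.Basic := by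
  simp [conj]

@[simp] lemma propEval_neg {v : Formula Φ → Prop} {α : Formula Φ} :
    (neg α).PropEval v ↔ ¬ α.PropEval v := Iff.rfl

@[simp] lemma propEval_disj {v : Formula Φ → Prop} {α β : Formula Φ} :
    (disj α β).PropEval v ↔ α.PropEval v ∨ β.PropEval v := Iff.rfl

@[simp] lemma propEval_imp {v : Formula Φ → Prop} {α β : Formula Φ} :
    (imp α β).PropEval v ↔ (α.PropEval v → β.PropEval v) := by
  simp only [imp, propEval_disj, propEval_neg]; tauto

@[simp] lemma propEval_conj {v : Formula Φ → Prop} {α β : Formula Φ} :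
    (conj α β).PropEval v ↔ α.PropEval v ∧ β.PropEval v := by
  simp only [conj, propEval_disj, propEval_neg]; tauto

/-- The atom `q` does not occur in the formula. -/
def Fresh (q : Φ) : Formula Φ → Prop
  | atom p => p ≠ q
  | neg α => α.Fresh q
  | disj α β => α.Fresh q ∧ β.Fresh q
  | L _ α => α.Fresh q
  | N _ α => α.Fresh q

lemma finite_not_fresh (α : Formula Φ) : {q | ¬ α.Fresh q}.Finite := by
  induction α with
  | atom p => exact (Set.finite_singleton p).subset fun q hq => (not_not.1 hq).symm
  | neg α ih => exact ih
  | disj α β ihα ihβ =>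
    exact (ihα.union ihβ).subset fun q hq => not_and_or.1 hq
  | L i α ih => exact ih
  | N i α ih => exact ih

lemma exists_fresh [Infinite Φ] (α : Formula Φ) : ∃ q, α.Fresh q := by
  obtain ⟨q, hq⟩ := (finite_not_fresh α).exists_notMem
  exact ⟨q, not_not.1 hq⟩

/-- The least depth of a structure for agent `i` at which a formula can be evaluated without
meeting a trivial structure. Unlike `depth`, it vanishes on `i`-objective formulas. -/
def rank : Formula Φ → Agent → ℕ
  | atom _, _ => 0
  | neg α, i => α.rank i
  | disj α β, i => max (α.rank i) (β.rank i)
  | L j α, i => if j = i then max (α.rank i) (α.rank i.other + 1) else 0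
  | N j α, i => if j = i then max (α.rank i) (α.rank i.other + 1) else 0

lemma rank_of_objective {i : Agent} {α : Formula Φ} (h : α.Objective i) : α.rank i = 0 := by
  induction α with
  | atom p => rfl
  | neg α ih => exact ih h
  | disj α β ihα ihβ => simp [rank, ihα h.1, ihβ h.2]
  | L j α => exact if_neg h
  | N j α => exact if_neg h

lemma rank_le_depth (α : Formula Φ) (i : Agent) :
    α.rank i ≤ α.depth i ∧ α.rank i + 1 ≤ α.depth i.other := by
  induction α generalizing i with
  | atom p => simp [rank, depth]
  | neg α ih => exact ih i
  | disj α β ihα ihβ =>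
    have h₁ := ihα i
    have h₂ := ihβ i
    simp only [rank, depth]
    omega
  | L j α ih =>
    have h₁ := ih i
    have h₂ := ih i.other
    simp only [Agent.other_other] at h₂
    by_cases hj : j = i
    · subst hj
      simp only [rank, depth, if_true, Agent.ne_other, if_false]
      omega
    · obtain rfl := Agent.eq_other_of_ne hj
      simp only [rank, depth, if_true, Agent.other_ne, if_false]
      omega
  | N j α ih =>
    have h₁ := ih i
    have h₂ := ih i.other
    simp only [Agent.other_other] at h₂
    by_cases hj : j = i
    · subst hj
      simp only [rank, depth, if_true, Agent.ne_other, if_false]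
      omega
    · obtain rfl := Agent.eq_other_of_ne hj
      simp only [rank, depth, if_true, Agent.other_ne, if_false]
      omega

end Formula

/-- The hierarchy `ONL¹ ⊆ ONL² ⊆ …`, extended downwards by the basic formulas as level `0`. -/
def Lang (Φ : Type u) : ℕ → Set (Formula Φ)
  | 0 => {α | α.Basic}
  | t + 1 => ONL Φ (t + 1)

lemma atom_mem_Lang (p : Φ) : ∀ t, atom p ∈ Lang Φ t
  | 0 => fun _ => trivial
  | 1 => trivial
  | t + 2 => .base (.inl (atom_mem_Lang p (t + 1)))

lemma neg_mem_Lang {α : Formula Φ} : ∀ {t}, neg α ∈ Lang Φ t ↔ α ∈ Lang Φ t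
  | 0 => Iff.rfl
  | 1 => Iff.rfl
  | t + 2 => by
    refine ⟨fun h => ?_, .neg⟩
    cases h with
    | base h =>
      rcases h with h | ⟨i, γ, -, h | h⟩
      · exact .base (.inl (neg_mem_Lang (t := t + 1) |>.1 h))
      · cases h
      · cases h
    | neg h => exact h

lemma disj_mem_Lang {α β : Formula Φ} :
    ∀ {t}, disj α β ∈ Lang Φ t ↔ α ∈ Lang Φ t ∧ β ∈ Lang Φ t
  | 0 => basic_disj
  | 1 => Iff.rfl
  | t + 2 => by
    refine ⟨fun h => ?_, fun h => .disj h.1 h.2⟩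
    cases h with
    | base h =>
      rcases h with h | ⟨i, γ, -, h | h⟩
      · have := disj_mem_Lang (t := t + 1) |>.1 h
        exact ⟨.base (.inl this.1), .base (.inl this.2)⟩
      · cases h
      · cases h
    | disj h₁ h₂ => exact ⟨h₁, h₂⟩

lemma conj_mem_Lang {α β : Formula Φ} {t : ℕ} :
    conj α β ∈ Lang Φ t ↔ α ∈ Lang Φ t ∧ β ∈ Lang Φ t := by
  simp only [conj, neg_mem_Lang, disj_mem_Lang]

lemma Formula.Basic.inONLMinus {α : Formula Φ} (h : α.Basic) : α.InONLMinus := by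
  induction α with
  | atom p => trivial
  | neg α ih => exact ih h
  | disj α β ihα ihβ => exact ⟨ihα (basic_disj.1 h).1, ihβ (basic_disj.1 h).2⟩
  | L i α ih => exact ⟨ih h, h _⟩
  | N i α => exact absurd h not_basic_N

lemma Lang_subset_succ : ∀ t, Lang Φ t ⊆ Lang Φ (t + 1)
  | 0 => fun _ h => Formula.Basic.inONLMinus h
  | _ + 1 => fun _ h => .base (.inl h)

lemma Lang_mono : Monotone (Lang Φ) := monotone_nat_of_le_succ Lang_subset_succ

/-- The formulas that occur directly in the scope of an operator of agent `i` within `Lang t`: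
their operators of the other agent belong to `Lang (t - 1)`, up to those nested in operators of
`i`. The operator `N i` is excluded at level `0`. -/
def InScope (t : ℕ) (i : Agent) : Formula Φ → Prop
  | atom _ => True
  | neg α => InScope t i α
  | disj α β => InScope t i α ∧ InScope t i β
  | L j α => if j = i then InScope t i α else L j α ∈ Lang Φ (t - 1)
  | N j α => if j = i then 1 ≤ t ∧ InScope t i α else N j α ∈ Lang Φ (t - 1)

lemma InScope.mono {s t : ℕ} (hst : s ≤ t) {i : Agent} {α : Formula Φ} (h : InScope s i α) :
    InScope t i α := by
  have hL : Lang Φ (s - 1) ⊆ Lang Φ (t - 1) := Lang_mono (by omega)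
  induction α with
  | atom p => trivial
  | neg α ih => exact ih h
  | disj α β ihα ihβ => exact ⟨ihα h.1, ihβ h.2⟩
  | L j α ih =>
    by_cases hj : j = i
    · simp only [InScope, if_pos hj] at h ⊢
      exact ih h
    · simp only [InScope, if_neg hj] at h ⊢
      exact hL h
  | N j α ih =>
    by_cases hj : j = i
    · simp only [InScope, if_pos hj] at h ⊢
      exact ⟨h.1.trans hst, ih h.2⟩
    · simp only [InScope, if_neg hj] at h ⊢
      exact hL h

lemma Formula.Basic.inScope_zero {i : Agent} {α : Formula Φ} (h : α.Basic) : InScope 0 i α := by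
  induction α with
  | atom p => trivial
  | neg α ih => exact ih h
  | disj α β ihα ihβ => exact ⟨ihα (basic_disj.1 h).1, ihβ (basic_disj.1 h).2⟩
  | L j α ih =>
    by_cases hj : j = i
    · simp only [InScope, if_pos hj]
      exact ih h
    · simp only [InScope, if_neg hj]
      exact h
  | N i α => exact absurd h not_basic_N

lemma Formula.InONLMinus.inScope_one {i : Agent} {α : Formula Φ} (h : α.InONLMinus)
    (hN : α.NFree i.other) : InScope 1 i α := by
  induction α with
  | atom p => trivial
  | neg α ih => exact ih h hN
  | disj α β ihα ihβ => exact ⟨ihα h.1 hN.1, ihβ h.2 hN.2⟩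
  | L j α ih =>
    by_cases hj : j = i
    · simp only [InScope, if_pos hj]
      exact ih h.1 hN
    · simp only [InScope, if_neg hj]
      obtain rfl := Agent.eq_other_of_ne hj
      have := h.2
      rw [Agent.other_other] at this
      exact (Agent.forall_iff i).2 ⟨this, hN⟩
  | N j α ih =>
    by_cases hj : j = i
    · simp only [InScope, if_pos hj]
      exact ⟨le_rfl, ih h.1 hN.2⟩
    · exact absurd (Agent.eq_other_of_ne hj) hN.1

lemma inScope_of_mem_Lang : ∀ {t : ℕ} {i : Agent} {α : Formula Φ},
    (L i α ∈ Lang Φ t → InScope t i α) ∧ (N i α ∈ Lang Φ t → 1 ≤ t ∧ InScope t i α)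
  | 0, i, α => ⟨fun h => Formula.Basic.inScope_zero h, fun h => absurd h not_basic_N⟩
  | 1, i, α => ⟨fun h => h.1.inScope_one h.2, fun h => ⟨le_rfl, h.1.inScope_one h.2⟩⟩
  | t + 2, i, α => by
    have hstep : ∀ β : Formula Φ, β ∈ Lang Φ (t + 1) → InScope (t + 2) i β := by
      intro β hβ
      induction β with
      | atom p => trivial
      | neg β ih => exact ih (neg_mem_Lang.1 hβ)
      | disj β γ ihβ ihγ =>
        exact ⟨ihβ (disj_mem_Lang.1 hβ).1, ihγ (disj_mem_Lang.1 hβ).2⟩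
      | L j β =>
        by_cases hj : j = i
        · subst hj
          simp only [InScope, if_true]
          exact (inScope_of_mem_Lang.1 hβ).mono (by omega)
        · simp only [InScope, if_neg hj]
          exact hβ
      | N j β =>
        by_cases hj : j = i
        · subst hj
          simp only [InScope, if_true]
          exact ⟨by omega, (inScope_of_mem_Lang.2 hβ).2.mono (by omega)⟩
        · simp only [InScope, if_neg hj]
          exact hβ
    constructor
    · intro h
      cases h with
      | base h =>
        rcases h with h | ⟨j, γ, hγ, h | h⟩
        · exact (inScope_of_mem_Lang (t := t + 1) |>.1 h).mono (by omega)
        · cases h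
          exact hstep _ hγ
        · cases h
    · intro h
      refine ⟨by omega, ?_⟩
      cases h with
      | base h =>
        rcases h with h | ⟨j, γ, hγ, h | h⟩
        · exact (inScope_of_mem_Lang (t := t + 1) |>.2 h).2.mono (by omega)
        · cases h
        · cases h
          exact hstep _ hγ

/-! ### Derivations, and conservativity over `K45` -/

lemma Deriv.mono {A A' : Agent → Formula Φ → Prop} (hA : ∀ i α, A i α → A' i α)
    {φ : Formula Φ} (h : Deriv A φ) : Deriv A' φ := by
  induction h with
  | a1 h => exact .a1 h
  | a2 i α β => exact .a2 i α β
  | a3 i α β => exact .a3 i α β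
  | a4 i h => exact .a4 i h
  | a5 h => exact .a5 (hA _ _ h)
  | mp _ _ ih₁ ih₂ => exact .mp ih₁ ih₂
  | necL i _ ih => exact .necL i ih
  | necN i _ ih => exact .necN i ih

/-- Derivability is closed under tautological consequence. -/
lemma Deriv.of_entails {A : Agent → Formula Φ → Prop} (l : List (Formula Φ)) {φ : Formula Φ}
    (hl : ∀ θ ∈ l, Deriv A θ)
    (h : ∀ v : Formula Φ → Prop, (∀ θ ∈ l, θ.PropEval v) → φ.PropEval v) : Deriv A φ := by
  induction l generalizing φ with
  | nil => exact .a1 fun v => h v (by simp)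
  | cons θ l ih =>
    refine .mp (α := θ) (ih (fun x hx => hl x (by simp [hx])) fun v hv => ?_) (hl θ (by simp))
    rw [propEval_imp]
    intro hθ
    exact h v (by simpa using ⟨hθ, hv⟩)

lemma K45.basic {φ : Formula Φ} (h : K45 φ) : φ.Basic := by
  induction h with
  | taut h _ => exact h
  | axK i h₁ h₂ => simp [h₁, h₂]
  | ax4 i h => simp [h]
  | ax5 i h => simp [h]
  | mp _ _ ih _ => exact (basic_imp.1 ih).2
  | nec i _ ih => exact ih

lemma K45.of_entails (l : List (Formula Φ)) {φ : Formula Φ} (hφ : φ.Basic)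
    (hl : ∀ θ ∈ l, K45 θ)
    (h : ∀ v : Formula Φ → Prop, (∀ θ ∈ l, θ.PropEval v) → φ.PropEval v) : K45 φ := by
  induction l generalizing φ with
  | nil => exact .taut hφ fun v => h v (by simp)
  | cons θ l ih =>
    have hθ := hl θ (by simp)
    refine .mp (α := θ) (ih (basic_imp.2 ⟨hθ.basic, hφ⟩) (fun x hx => hl x (by simp [hx]))
      fun v hv => ?_) hθ
    rw [propEval_imp]
    intro hθ
    exact h v (by simpa using ⟨hθ, hv⟩)

lemma K45.deriv {A : Agent → Formula Φ → Prop} {φ : Formula Φ} (h : K45 φ) : Deriv A φ := by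
  induction h with
  | taut _ h => exact .a1 h
  | axK i _ _ => exact .a2 i _ _
  | @ax4 i α _ =>
    refine .of_entails [_] (by simpa using Deriv.a4 i (σ := L i α) rfl) fun v hv => ?_
    simp at hv ⊢
    tauto
  | @ax5 i α _ =>
    refine .of_entails [_] (by simpa using Deriv.a4 i (σ := neg (L i α)) rfl) fun v hv => ?_
    simp at hv ⊢
    tauto
  | mp _ _ ih₁ ih₂ => exact .mp ih₁ ih₂
  | nec i _ ih => exact .necL i ih

lemma K45.box_mono (i : Agent) {α β : Formula Φ} (h : K45 (imp α β)) :
    K45 (imp (L i α) (L i β)) :=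
  .mp (.axK i (basic_imp.1 h.basic).1 (basic_imp.1 h.basic).2) (.nec i h)

/-- Agents are fully introspective about their basic subjective formulas, not only about the
formulas `L i α` of the axioms `4` and `5`. -/
lemma K45.subjective {i : Agent} {σ : Formula Φ} (hb : σ.Basic) (hs : σ.Subjective i) :
    K45 (imp σ (L i σ)) ∧ K45 (imp (neg σ) (L i (neg σ))) := by
  induction σ with
  | atom p => exact hs.elim
  | neg σ ih =>
    obtain ⟨h₁, h₂⟩ := ih hb hs
    refine ⟨h₂, ?_⟩
    have h₃ : K45 (imp (L i σ) (L i (neg (neg σ)))) :=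
      K45.box_mono i (.taut (by simpa using hb) fun v => by simp)
    refine .of_entails [_, _] (by simpa using hb) (by simpa using ⟨h₁, h₃⟩) fun v hv => ?_
    simp at hv ⊢
    tauto
  | disj σ τ ihσ ihτ =>
    rw [basic_disj] at hb
    obtain ⟨h₁, h₂⟩ := ihσ hb.1 hs.1
    obtain ⟨h₃, h₄⟩ := ihτ hb.2 hs.2
    have h₅ : K45 (imp (L i σ) (L i (disj σ τ))) :=
      K45.box_mono i (.taut (by simp [hb]) fun v => by simp; tauto)
    have h₆ : K45 (imp (L i τ) (L i (disj σ τ))) :=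
      K45.box_mono i (.taut (by simp [hb]) fun v => by simp; tauto)
    have h₇ : K45 (imp (L i (neg σ)) (L i (imp (neg τ) (neg (disj σ τ))))) :=
      K45.box_mono i (.taut (by simp [hb]) fun v => by simp; tauto)
    have h₈ : K45 (imp (L i (imp (neg τ) (neg (disj σ τ))))
        (imp (L i (neg τ)) (L i (neg (disj σ τ))))) :=
      .axK i (by simp [hb]) (by simp [hb])
    constructor
    · refine .of_entails [_, _, _, _] (by simp [hb]) (by simpa using ⟨h₁, h₃, h₅, h₆⟩)
        fun v hv => ?_
      simp only [List.forall_mem_cons, propEval_imp, propEval_disj] at hv ⊢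
      grind
    · refine .of_entails [_, _, _, _] (by simp [hb]) (by simpa using ⟨h₂, h₄, h₇, h₈⟩)
        fun v hv => ?_
      simp only [List.forall_mem_cons, propEval_imp, propEval_neg, propEval_disj] at hv ⊢
      grind
  | L j σ =>
    obtain rfl : j = i := hs
    exact ⟨.ax4 j hb, .ax5 j hb⟩
  | N j σ => exact absurd hb not_basic_N

/-- The basic formula obtained by reading every `N i` as `L i`. -/
def Formula.eraseN : Formula Φ → Formula Φ
  | atom p => atom p
  | neg α => neg α.eraseN
  | disj α β => disj α.eraseN β.eraseN
  | L i α => L i α.eraseN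
  | N i α => L i α.eraseN

lemma Formula.basic_eraseN (α : Formula Φ) : α.eraseN.Basic := by
  induction α <;> simp_all [eraseN]

lemma Formula.eraseN_eq_self {α : Formula Φ} (h : α.Basic) : α.eraseN = α := by
  induction α <;> simp_all [eraseN]

lemma Formula.subjective_eraseN {i : Agent} {σ : Formula Φ} (h : σ.Subjective i) :
    σ.eraseN.Subjective i := by
  induction σ with
  | atom p => exact h
  | neg σ ih => exact ih h
  | disj σ τ ihσ ihτ => exact ⟨ihσ h.1, ihτ h.2⟩
  | L j σ => exact h
  | N j σ => exact h

lemma Formula.propEval_eraseN (v : Formula Φ → Prop) (α : Formula Φ) :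
    α.eraseN.PropEval v ↔ α.PropEval fun β => β.eraseN.PropEval v := by
  induction α with
  | neg α ih => simp [eraseN, ih]
  | disj α β ihα ihβ => simp [eraseN, ihα, ihβ]
  | _ => rfl

/-- Without `A5`, the operators `N i` obey no more laws than the `L i`. -/
lemma Deriv.eraseN {φ : Formula Φ} (h : Deriv (fun _ _ => False) φ) : K45 φ.eraseN := by
  induction h with
  | @a1 α h => exact .taut α.basic_eraseN fun v => (propEval_eraseN v α).2 (h _)
  | a2 i α β => exact .axK i α.basic_eraseN β.basic_eraseN
  | a3 i α β => exact .axK i α.basic_eraseN β.basic_eraseN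
  | @a4 i σ h =>
    have := (K45.subjective σ.basic_eraseN (subjective_eraseN h)).1
    have hb := σ.basic_eraseN
    refine .of_entails [_] (Formula.basic_eraseN _) (by simpa using this) fun v hv => ?_
    simp [Formula.eraseN, imp, conj] at hv ⊢
    tauto
  | a5 h => exact h.elim
  | mp _ _ ih₁ ih₂ => exact .mp ih₁ ih₂
  | necL i _ ih => exact .nec i ih
  | necN i _ ih => exact .nec i ih

/-- With the basic formulas as level `0`, the axioms `A5¹` follow the same pattern as the later
ones, since `K45` and `A1`–`A4` prove the same basic formulas. -/
lemma a5UpTo_succ {t : ℕ} {i : Agent} {α : Formula Φ} :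
    A5UpTo (t + 1) i α ↔ A5UpTo t i α ∨
      (neg α ∈ Lang Φ t ∧ (neg α).Objective i ∧ ¬ Deriv (A5UpTo t) (neg (neg α))) := by
  cases t with
  | succ t => exact Iff.rfl
  | zero =>
    have h0 : A5UpTo (Φ := Φ) 0 = fun _ _ => False := by
      funext i α
      rfl
    have h : (neg α).Basic → (K45 (neg (neg α)) ↔ Deriv (A5UpTo 0) (neg (neg α))) := by
      refine fun hb => ⟨K45.deriv, fun h => ?_⟩
      rw [h0] at h
      exact eraseN_eq_self (α := neg (neg α)) hb ▸ h.eraseN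
    simp only [A5UpTo, Lang, false_or, Set.mem_ofPred_eq]
    exact and_congr_right fun hb => and_congr_right fun _ => not_congr (h hb)

lemma a5UpTo_mono {s t : ℕ} (hst : s ≤ t) (i : Agent) (α : Formula Φ) (h : A5UpTo s i α) :
    A5UpTo t i α := by
  induction hst with
  | refl => exact h
  | step _ ih => exact a5UpTo_succ.2 (.inl ih)

/-! ### Semantics relative to an agent -/

/-- The trivial structure. -/
def KStruct.trivial : KStruct Φ 0 := PUnit.unit

/-- Truth with the structures listed from the point of view of agent `i`: `e` is the structure of
`i` and `f` that of the other agent. -/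
def SatAt (i : Agent) (φ : Formula Φ) {k l : ℕ} (e : KStruct Φ k) (f : KStruct Φ l)
    (w : Set Φ) : Prop :=
  match i with
  | .a => Sat φ k l e f w
  | .b => Sat φ l k f e w

lemma satAt_other {i : Agent} {φ : Formula Φ} {k l : ℕ} {e : KStruct Φ k} {f : KStruct Φ l}
    {w : Set Φ} : SatAt i.other φ f e w ↔ SatAt i φ e f w := by
  cases i <;> rfl

section
variable {i : Agent} {k l : ℕ} {e : KStruct Φ k} {f : KStruct Φ l} {w : Set Φ}

@[simp] lemma satAt_atom {p : Φ} : SatAt i (atom p) e f w ↔ p ∈ w := by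
  cases i <;> simp [SatAt, Sat]

@[simp] lemma satAt_neg {α : Formula Φ} : SatAt i (neg α) e f w ↔ ¬ SatAt i α e f w := by
  cases i <;> simp [SatAt, Sat]

@[simp] lemma satAt_disj {α β : Formula Φ} :
    SatAt i (disj α β) e f w ↔ SatAt i α e f w ∨ SatAt i β e f w := by
  cases i <;> simp [SatAt, Sat]

@[simp] lemma satAt_imp {α β : Formula Φ} :
    SatAt i (imp α β) e f w ↔ (SatAt i α e f w → SatAt i β e f w) := by
  simp only [imp, satAt_disj, satAt_neg]; tauto

@[simp] lemma satAt_conj {α β : Formula Φ} :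
    SatAt i (conj α β) e f w ↔ SatAt i α e f w ∧ SatAt i β e f w := by
  simp only [conj, satAt_disj, satAt_neg]; tauto

lemma satAt_L {α : Formula Φ} {e : KStruct Φ (k + 1)} :
    SatAt i (L i α) e f w ↔ ∀ v x, e.Mem v x → SatAt i α e x v := by
  cases i <;> simp [SatAt, Sat]

lemma satAt_N {α : Formula Φ} {e : KStruct Φ (k + 1)} :
    SatAt i (N i α) e f w ↔ ∀ v x, ¬ e.Mem v x → SatAt i α e x v := by
  cases i <;> simp [SatAt, Sat]

lemma satAt_L_zero {j : Agent} {α : Formula Φ} {e : KStruct Φ 0} :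
    SatAt j (L j α) e f w := by
  cases j <;> cases l <;> simp [SatAt, Sat]

lemma satAt_N_zero {j : Agent} {α : Formula Φ} {e : KStruct Φ 0} :
    SatAt j (N j α) e f w := by
  cases j <;> cases l <;> simp [SatAt, Sat]

end

/-- The truth of a subjective formula depends on the structure of its agent only. -/
lemma satAt_subjective {i : Agent} {σ : Formula Φ} (h : σ.Subjective i) {k l l' : ℕ}
    {e : KStruct Φ k} {f : KStruct Φ l} {f' : KStruct Φ l'} {w w' : Set Φ} :
    SatAt i σ e f w ↔ SatAt i σ e f' w' := by
  induction σ with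
  | atom p => exact h.elim
  | neg σ ih => simp only [satAt_neg, ih h]
  | disj σ τ ihσ ihτ => simp only [satAt_disj, ihσ h.1, ihτ h.2]
  | L j σ =>
    obtain rfl : j = i := h
    cases k with
    | zero => exact iff_of_true satAt_L_zero satAt_L_zero
    | succ k => rw [satAt_L, satAt_L]
  | N j σ =>
    obtain rfl : j = i := h
    cases k with
    | zero => exact iff_of_true satAt_N_zero satAt_N_zero
    | succ k => rw [satAt_N, satAt_N]

/-- The truth of an objective formula does not depend on the structure of its agent. -/
lemma satAt_objective {i : Agent} {φ : Formula Φ} (h : φ.Objective i) {k k' l : ℕ}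
    {e : KStruct Φ k} {e' : KStruct Φ k'} {f : KStruct Φ l} {w : Set Φ} :
    SatAt i φ e f w ↔ SatAt i φ e' f w := by
  induction φ with
  | atom p => simp
  | neg φ ih => simp only [satAt_neg, ih h]
  | disj φ ψ ihφ ihψ => simp only [satAt_disj, ihφ h.1, ihψ h.2]
  | L j φ =>
    obtain rfl := Agent.eq_other_of_ne h
    rw [← satAt_other, ← satAt_other (e := e')]
    exact satAt_subjective (σ := L i.other φ) rfl
  | N j φ =>
    obtain rfl := Agent.eq_other_of_ne h
    rw [← satAt_other, ← satAt_other (e := e')]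
    exact satAt_subjective (σ := N i.other φ) rfl

/-! ### Changing the depth of a structure -/

/-- The worlds agree on all propositions other than `q`. -/
def AgreeOff (q : Φ) (w w' : Set Φ) : Prop := ∀ p, p ≠ q → (p ∈ w ↔ p ∈ w')

/-- Back-and-forth equivalence up to depth `d`, disregarding the proposition `q`. Both the members
and the non-members of the structures are matched, as `N` quantifies over the latter. -/
def Sim (q : Φ) : ℕ → {k k' : ℕ} → KStruct Φ k → KStruct Φ k' → Prop
  | 0, _, _, _, _ => True
  | d + 1, k + 1, k' + 1, e, e' =>
      (∀ (w : Set Φ) (x : KStruct Φ k), ∃ (w' : Set Φ) (x' : KStruct Φ k'),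
        (e.Mem w x ↔ e'.Mem w' x') ∧ AgreeOff q w w' ∧ Sim q d x x') ∧
      (∀ (w' : Set Φ) (x' : KStruct Φ k'), ∃ (w : Set Φ) (x : KStruct Φ k),
        (e.Mem w x ↔ e'.Mem w' x') ∧ AgreeOff q w w' ∧ Sim q d x x')
  | _ + 1, _, _, _, _ => False

lemma AgreeOff.symm {q : Φ} {w w' : Set Φ} (h : AgreeOff q w w') : AgreeOff q w' w :=
  fun p hp => (h p hp).symm

lemma AgreeOff.refl (q : Φ) (w : Set Φ) : AgreeOff q w w := fun _ _ => Iff.rfl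

lemma agreeOff_insert (q : Φ) (w : Set Φ) : AgreeOff q w (insert q w) := by
  intro p hp; simp [hp]

lemma agreeOff_diff (q : Φ) (w : Set Φ) : AgreeOff q w (w \ {q}) := by
  intro p hp; simp [hp]

lemma Sim.symm {q : Φ} {d : ℕ} : ∀ {k k' : ℕ} {e : KStruct Φ k} {e' : KStruct Φ k'},
    Sim q d e e' → Sim q d e' e := by
  induction d with
  | zero => intros; trivial
  | succ d ih =>
    intro k k' e e' h
    match k, k', e, e', h with
    | k + 1, k' + 1, e, e', h =>
      refine ⟨fun w x => ?_, fun w x => ?_⟩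
      · obtain ⟨w', x', h₁, h₂, h₃⟩ := h.2 w x
        exact ⟨w', x', h₁.symm, h₂.symm, ih h₃⟩
      · obtain ⟨w', x', h₁, h₂, h₃⟩ := h.1 w x
        exact ⟨w', x', h₁.symm, h₂.symm, ih h₃⟩

lemma Sim.refl (q : Φ) (d : ℕ) : ∀ {k : ℕ}, d ≤ k → ∀ e : KStruct Φ k, Sim q d e e := by
  induction d with
  | zero => intros; exact True.intro
  | succ d ih =>
    intro k hk e
    match k, e, hk with
    | k + 1, e, hk =>
      have h : ∀ x : KStruct Φ k, Sim q d x x := ih (by omega)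
      exact ⟨fun w x => ⟨w, x, Iff.rfl, .refl q w, h x⟩,
        fun w x => ⟨w, x, Iff.rfl, .refl q w, h x⟩⟩

/-- Every structure has an equivalent one of any other sufficient depth. -/
lemma exists_sim (q : Φ) (d : ℕ) : ∀ {k k' : ℕ}, d ≤ k → d ≤ k' → ∀ e : KStruct Φ k,
    ∃ e' : KStruct Φ k', Sim q d e e' := by
  induction d with
  | zero =>
    intro k k' _ _ _
    exact ⟨match k' with | 0 => KStruct.trivial | _ + 1 => (∅ : Set _), trivial⟩
  | succ d ih =>
    intro k k' hk hk' e
    match k, k', e, hk, hk' with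
    | k + 1, k' + 1, e, hk, hk' =>
      let In (b : Prop) (w' : Set Φ) (x' : KStruct Φ k') : Prop :=
        ∃ w x, (e.Mem w x ↔ b) ∧ AgreeOff q w w' ∧ Sim q d x x'
      -- A class that meets both `e` and its complement has to be split: `q` serves for that.
      let e' : Set (Set Φ × KStruct Φ k') :=
        {y | In True y.1 y.2 ∧ (q ∈ y.1 ∨ ¬ In False y.1 y.2)}
      have he' : ∀ w' x', KStruct.Mem (k := k') e' w' x' ↔
          In True w' x' ∧ (q ∈ w' ∨ ¬ In False w' x') := fun _ _ => Iff.rfl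
      refine ⟨e', fun w x => ?_, fun w' x' => ?_⟩
      · obtain ⟨x', hx⟩ := ih (k' := k') (by omega) (by omega) x
        by_cases hm : e.Mem w x
        · refine ⟨insert q w, x', iff_of_true hm ?_, agreeOff_insert q w, hx⟩
          exact (he' _ _).2 ⟨⟨w, x, by simpa, agreeOff_insert q w, hx⟩, .inl (by simp)⟩
        · refine ⟨w \ {q}, x', iff_of_false hm fun h => ?_, agreeOff_diff q w, hx⟩
          exact ((he' _ _).1 h).2.elim (by simp) fun h =>
            h ⟨w, x, by simpa, agreeOff_diff q w, hx⟩
      · by_cases hm : KStruct.Mem (k := k') e' w' x'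
        · obtain ⟨w, x, h₁, h₂, h₃⟩ := ((he' _ _).1 hm).1
          exact ⟨w, x, by simpa [hm] using h₁, h₂, h₃⟩
        · have hF : In False w' x' := by
            obtain ⟨x, hx⟩ := ih (k' := k) (by omega) (by omega) x'
            by_cases hx' : e.Mem w' x
            · have hT : In True w' x' := ⟨w', x, by simpa, .refl q w', hx.symm⟩
              by_contra hF
              exact hm ((he' _ _).2 ⟨hT, .inr hF⟩)
            · exact ⟨w', x, by simpa, .refl q w', hx.symm⟩
          obtain ⟨w, x, h₁, h₂, h₃⟩ := hF
          exact ⟨w, x, by simpa [hm] using h₁, h₂, h₃⟩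

lemma Sim.satAt_iff {q : Φ} {φ : Formula Φ} (hq : φ.Fresh q) {i : Agent} {d d' k k' l l' : ℕ}
    {e : KStruct Φ k} {e' : KStruct Φ k'} {f : KStruct Φ l} {f' : KStruct Φ l'} {w w' : Set Φ}
    (he : Sim q d e e') (hf : Sim q d' f f') (hw : AgreeOff q w w') (hd : φ.rank i ≤ d)
    (hd' : φ.rank i.other ≤ d') : SatAt i φ e f w ↔ SatAt i φ e' f' w' := by
  induction φ generalizing i d d' k k' l l' w w' with
  | atom p => simpa using hw p hq
  | neg φ ih => simp only [satAt_neg, ih hq he hf hw hd hd']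
  | disj φ ψ ihφ ihψ =>
    simp only [rank, max_le_iff] at hd hd'
    simp only [satAt_disj, ihφ hq.1 he hf hw hd.1 hd'.1, ihψ hq.2 he hf hw hd.2 hd'.2]
  | L j φ ih =>
    wlog hj : j = i generalizing i d d' k k' l l' with H
    · rw [← satAt_other, ← satAt_other (e := e')]
      exact H hf he hd' (by simpa using hd) (Agent.eq_other_of_ne hj)
    subst hj
    simp only [rank, if_true, max_le_iff] at hd
    match d, k, k', e, e', he, hd with
    | d + 1, k + 1, k' + 1, e, e', he, hd =>
      have hstep : ∀ {v v'} {x : KStruct Φ k} {x' : KStruct Φ k'}, AgreeOff q v v' → Sim q d x x' →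
          (SatAt j φ e x v ↔ SatAt j φ e' x' v') :=
        fun hv hx => ih hq he hx hv hd.1 (by omega)
      rw [satAt_L, satAt_L]
      constructor
      · intro h v' x' hm
        obtain ⟨v, x, h₁, h₂, h₃⟩ := he.2 v' x'
        exact (hstep h₂ h₃).1 (h v x (h₁.2 hm))
      · intro h v x hm
        obtain ⟨v', x', h₁, h₂, h₃⟩ := he.1 v x
        exact (hstep h₂ h₃).2 (h v' x' (h₁.1 hm))
  | N j φ ih =>
    wlog hj : j = i generalizing i d d' k k' l l' with H
    · rw [← satAt_other, ← satAt_other (e := e')]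
      exact H hf he hd' (by simpa using hd) (Agent.eq_other_of_ne hj)
    subst hj
    simp only [rank, if_true, max_le_iff] at hd
    match d, k, k', e, e', he, hd with
    | d + 1, k + 1, k' + 1, e, e', he, hd =>
      have hstep : ∀ {v v'} {x : KStruct Φ k} {x' : KStruct Φ k'}, AgreeOff q v v' → Sim q d x x' →
          (SatAt j φ e x v ↔ SatAt j φ e' x' v') :=
        fun hv hx => ih hq he hx hv hd.1 (by omega)
      rw [satAt_N, satAt_N]
      constructor
      · intro h v' x' hm
        obtain ⟨v, x, h₁, h₂, h₃⟩ := he.2 v' x'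
        exact (hstep h₂ h₃).1 (h v x (mt h₁.1 hm))
      · intro h v x hm
        obtain ⟨v', x', h₁, h₂, h₃⟩ := he.1 v x
        exact (hstep h₂ h₃).2 (h v' x' (mt h₁.2 hm))

/-! ### Maximal consistent sets -/

/-- Maximal consistent sets of the system with the axioms `A5` for the pairs in `A`, described by
their closure properties. -/
structure IsMCS (A : Agent → Formula Φ → Prop) (Γ : Set (Formula Φ)) : Prop where
  thm : ∀ {φ}, Deriv A φ → φ ∈ Γ
  neg_mem : ∀ {φ}, neg φ ∈ Γ ↔ φ ∉ Γ
  disj_mem : ∀ {φ ψ}, disj φ ψ ∈ Γ ↔ φ ∈ Γ ∨ ψ ∈ Γ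

section
variable {A : Agent → Formula Φ → Prop} {Γ : Set (Formula Φ)}

lemma IsMCS.imp_mem (h : IsMCS A Γ) {φ ψ : Formula Φ} :
    imp φ ψ ∈ Γ ↔ (φ ∈ Γ → ψ ∈ Γ) := by
  rw [imp, h.disj_mem, h.neg_mem]; tauto

lemma IsMCS.conj_mem (h : IsMCS A Γ) {φ ψ : Formula Φ} :
    conj φ ψ ∈ Γ ↔ φ ∈ Γ ∧ ψ ∈ Γ := by
  rw [conj, h.neg_mem, h.disj_mem, h.neg_mem, h.neg_mem]; tauto

lemma IsMCS.of_imp {A' : Agent → Formula Φ → Prop} (hA : ∀ i α, A' i α → A i α)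
    (h : IsMCS A Γ) : IsMCS A' Γ :=
  ⟨fun hφ => h.thm (hφ.mono hA), h.neg_mem, h.disj_mem⟩

/-- A set whose elements are irrefutable and which is directed downwards under provable
implication is part of a maximal consistent set. This is compactness of propositional logic, by an
ultraproduct of truth assignments over the finite sets of formulas. -/
lemma exists_isMCS {S : Set (Formula Φ)} (hne : S.Nonempty)
    (hdir : ∀ x ∈ S, ∀ y ∈ S, ∃ z ∈ S, Deriv A (imp z x) ∧ Deriv A (imp z y))
    (hcon : ∀ z ∈ S, ¬ Deriv A (neg z)) : ∃ Γ, IsMCS A Γ ∧ S ⊆ Γ := by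
  classical
  set D : Set (Formula Φ) := {x | ∃ z ∈ S, Deriv A (imp z x)} with hD
  have hthm : ∀ x, Deriv A x → x ∈ D := fun x hx =>
    ⟨hne.some, hne.some_mem, .of_entails [x] (by simpa) fun v hv => by simp at hv ⊢; tauto⟩
  have hS : S ⊆ D := fun x hx => ⟨x, hx, .a1 fun v => by simp⟩
  have hfin : ∀ F : Finset (Formula Φ), ∃ z ∈ S, ∀ x ∈ F, x ∈ D → Deriv A (imp z x) := by
    intro F
    induction F using Finset.induction_on with
    | empty => exact ⟨hne.some, hne.some_mem, by simp⟩
    | insert x F _ ih =>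
      obtain ⟨z, hz, hF⟩ := ih
      by_cases hx : x ∈ D
      · obtain ⟨y, hy, hyx⟩ := hx
        obtain ⟨u, hu, huz, huy⟩ := hdir z hz y hy
        refine ⟨u, hu, fun x' hx' hD' => ?_⟩
        rcases Finset.mem_insert.1 hx' with rfl | hx'
        · refine .of_entails [imp u y, imp y x'] (by simp [*]) fun v hv => ?_
          simp at hv ⊢
          tauto
        · refine .of_entails [imp u z, imp z x'] (by simpa using ⟨huz, hF x' hx' hD'⟩) fun v hv => ?_
          simp at hv ⊢
          tauto
      · refine ⟨z, hz, fun x' hx' hD' => ?_⟩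
        rcases Finset.mem_insert.1 hx' with rfl | hx'
        · exact absurd hD' hx
        · exact hF x' hx' hD'
  have hval : ∀ F : Finset (Formula Φ), ∃ v : Formula Φ → Prop,
      ∀ x ∈ F, x ∈ D → x.PropEval v := by
    intro F
    obtain ⟨z, hz, hF⟩ := hfin F
    by_contra! hv
    refine hcon z hz (.of_entails ((F.filter (· ∈ D)).toList.map (imp z)) ?_ fun v h => ?_)
    · simpa using fun _ x hx hD h => h ▸ hF x hx hD
    · obtain ⟨x, hx, hxD, hxv⟩ := hv v
      have := h (imp z x) (List.mem_map_of_mem (by simpa using ⟨hx, hxD⟩))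
      rw [propEval_imp] at this
      exact fun hz => hxv (this hz)
  choose v hv using hval
  let U : Ultrafilter (Finset (Formula Φ)) := .of Filter.atTop
  have hU : ∀ φ : Formula Φ,
      φ.PropEval (fun x => ∀ᶠ F in U, x.PropEval (v F)) ↔ ∀ᶠ F in U, φ.PropEval (v F) := by
    intro φ
    induction φ with
    | neg φ ih => simp only [propEval_neg, ih, Ultrafilter.eventually_not]
    | disj φ ψ ihφ ihψ => simp only [propEval_disj, ihφ, ihψ, Ultrafilter.eventually_or]
    | _ => rfl
  have hDU : ∀ φ ∈ D, ∀ᶠ F in U, φ.PropEval (v F) := by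
    intro φ hφ
    refine Ultrafilter.of_le _ ?_
    filter_upwards [Filter.eventually_ge_atTop {φ}] with F hF
    exact hv F φ (hF (by simp)) hφ
  refine ⟨{φ | φ.PropEval fun x => ∀ᶠ F in U, x.PropEval (v F)},
    ⟨fun hφ => (hU _).2 (hDU _ (hthm _ hφ)), Iff.rfl, Iff.rfl⟩,
    fun φ hφ => (hU _).2 (hDU _ (hS hφ))⟩

lemma exists_isMCS_of_irrefutable {φ : Formula Φ} (h : ¬ Deriv A (neg φ)) :
    ∃ Γ, IsMCS A Γ ∧ φ ∈ Γ := by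
  obtain ⟨Γ, hΓ, hs⟩ := exists_isMCS (A := A) (S := {φ}) (Set.singleton_nonempty φ)
    (by
      intro x hx y hy
      rw [hx, hy]
      exact ⟨φ, rfl, .a1 fun v => by simp, .a1 fun v => by simp⟩)
    (by rintro z rfl; exact h)
  exact ⟨Γ, hΓ, hs rfl⟩

/-- The operator `f` on formulas satisfies the axiom `K` and necessitation. -/
structure IsNormal (A : Agent → Formula Φ → Prop) (f : Formula Φ → Formula Φ) : Prop where
  axK : ∀ α β, Deriv A (imp (f (imp α β)) (imp (f α) (f β)))
  nec : ∀ {α}, Deriv A α → Deriv A (f α)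

lemma isNormal_L (i : Agent) : IsNormal A (L i) := ⟨.a2 i, .necL i⟩

lemma isNormal_N (i : Agent) : IsNormal A (N i) := ⟨.a3 i, .necN i⟩

variable {f : Formula Φ → Formula Φ}

lemma IsNormal.mp_mem (hf : IsNormal A f) (h : IsMCS A Γ) {α β : Formula Φ}
    (h₁ : f (imp α β) ∈ Γ) (h₂ : f α ∈ Γ) : f β ∈ Γ :=
  h.imp_mem.1 (h.imp_mem.1 (h.thm (hf.axK α β)) h₁) h₂

lemma IsNormal.mono_mem (hf : IsNormal A f) (h : IsMCS A Γ) {α β : Formula Φ}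
    (h₁ : Deriv A (imp α β)) (h₂ : f α ∈ Γ) : f β ∈ Γ :=
  hf.mp_mem h (h.thm (hf.nec h₁)) h₂

lemma IsNormal.conj_mem (hf : IsNormal A f) (h : IsMCS A Γ) {α β : Formula Φ}
    (h₁ : f α ∈ Γ) (h₂ : f β ∈ Γ) : f (conj α β) ∈ Γ :=
  hf.mp_mem h (hf.mono_mem h (.a1 fun v => by simp; tauto) h₁) h₂

/-- A directed set of formulas `τ`, none of which is excluded by `f (¬ τ) ∈ Γ`, is part of an
`f`-successor of `Γ`. -/
lemma IsNormal.exists_successor (hf : IsNormal A f) (h : IsMCS A Γ) {T : Set (Formula Φ)}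
    (hne : T.Nonempty)
    (hdir : ∀ x ∈ T, ∀ y ∈ T, ∃ z ∈ T, Deriv A (imp z x) ∧ Deriv A (imp z y))
    (hT : ∀ τ ∈ T, f (neg τ) ∉ Γ) :
    ∃ Γ', IsMCS A Γ' ∧ (∀ γ, f γ ∈ Γ → γ ∈ Γ') ∧ T ⊆ Γ' := by
  obtain ⟨τ₀, hτ₀⟩ := hne
  have htop : f (imp τ₀ τ₀) ∈ Γ := h.thm (hf.nec (.a1 fun v => by simp))
  obtain ⟨Γ', hΓ', hsub⟩ := exists_isMCS (A := A)
    (S := {x | ∃ τ ∈ T, ∃ γ, f γ ∈ Γ ∧ x = conj τ γ}) ⟨_, τ₀, hτ₀, _, htop, rfl⟩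
    (by
      rintro _ ⟨τ, hτ, γ, hγ, rfl⟩ _ ⟨τ', hτ', γ', hγ', rfl⟩
      obtain ⟨u, hu, h₁, h₂⟩ := hdir τ hτ τ' hτ'
      refine ⟨_, ⟨u, hu, _, hf.conj_mem h hγ hγ', rfl⟩, ?_, ?_⟩
      · refine .of_entails [_] (by simpa using h₁) fun v hv => ?_
        simp at hv ⊢
        tauto
      · refine .of_entails [_] (by simpa using h₂) fun v hv => ?_
        simp at hv ⊢
        tauto)
    (by
      rintro _ ⟨τ, hτ, γ, hγ, rfl⟩ hd
      refine hT τ hτ (hf.mono_mem h ?_ hγ)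
      refine .of_entails [_] (by simpa using hd) fun v hv => ?_
      simp at hv ⊢
      tauto)
  exact ⟨Γ', hΓ', fun γ hγ => (hΓ'.conj_mem.1 (hsub ⟨τ₀, hτ₀, γ, hγ, rfl⟩)).2,
    fun τ hτ => (hΓ'.conj_mem.1 (hsub ⟨τ, hτ, _, htop, rfl⟩)).1⟩

lemma IsNormal.exists_successor_of_notMem (hf : IsNormal A f) (h : IsMCS A Γ) {α : Formula Φ}
    (hα : f α ∉ Γ) : ∃ Γ', IsMCS A Γ' ∧ (∀ γ, f γ ∈ Γ → γ ∈ Γ') ∧ α ∉ Γ' := by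
  obtain ⟨Γ', h₁, h₂, h₃⟩ := hf.exists_successor h (T := {neg α}) (Set.singleton_nonempty _)
    (by
      rintro x rfl y rfl
      exact ⟨_, rfl, .a1 fun v => by simp, .a1 fun v => by simp⟩)
    (by
      rintro τ rfl hτ
      exact hα (hf.mono_mem h (.a1 fun v => by simp) hτ))
  exact ⟨Γ', h₁, h₂, h₁.neg_mem.1 (h₃ rfl)⟩

/-- By `A4`, successors for the operators of `i` agree on the `i`-subjective formulas. -/
lemma IsMCS.subjective_mem_iff (h : IsMCS A Γ) {Γ' : Set (Formula Φ)} (h' : IsMCS A Γ')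
    {i : Agent} (hs : (∀ γ, L i γ ∈ Γ → γ ∈ Γ') ∨ ∀ γ, N i γ ∈ Γ → γ ∈ Γ') {σ : Formula Φ}
    (hσ : σ.Subjective i) : σ ∈ Γ' ↔ σ ∈ Γ := by
  have key : ∀ τ : Formula Φ, τ.Subjective i → τ ∈ Γ → τ ∈ Γ' := by
    intro τ hτ hm
    have := h.conj_mem.1 (h.imp_mem.1 (h.thm (.a4 i hτ)) hm)
    exact hs.elim (fun hs => hs _ this.1) fun hs => hs _ this.2
  refine ⟨fun hm => ?_, key σ hσ⟩
  by_contra hn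
  exact h'.neg_mem.1 (key (neg σ) hσ (h.neg_mem.2 hn)) hm

end

/-! ### Canonical structures -/

/-- Soundness in the limit: the theorems are true at all structures of sufficiently large depth.
Unlike validity, this notion is plainly preserved by the rules, which relate formulas of different
depths. -/
def EventuallySound (A : Agent → Formula Φ → Prop) : Prop :=
  ∀ φ, Deriv A φ → ∃ K, ∀ k l, K ≤ k → K ≤ l → ∀ (i : Agent) (e : KStruct Φ k) (f : KStruct Φ l)
    (w : Set Φ), SatAt i φ e f w

/-- The world `w` and the structure `x` of the other agent verify the same `i`-objective formulas
as `Γ`, among those of `Lang t` in which `q` does not occur and for which `x` is deep enough. -/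
def Agree (q : Φ) (t : ℕ) (i : Agent) (Γ : Set (Formula Φ)) {k : ℕ} (w : Set Φ)
    (x : KStruct Φ k) : Prop :=
  ∀ β ∈ Lang Φ t, β.Objective i → β.Fresh q → β.rank i.other ≤ k →
    (β ∈ Γ ↔ SatAt i β KStruct.trivial x w)

/-- Some `f`-successor of `Γ`, where `f` is `L i` or `N i`, agrees with `w` and `x` on the
`i`-objective formulas of the level below `t`. -/
def Possible (q : Φ) (t : ℕ) (i : Agent) (f : Formula Φ → Formula Φ) (Γ : Set (Formula Φ))
    {k : ℕ} (w : Set Φ) (x : KStruct Φ k) : Prop :=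
  ∃ Γ', IsMCS (A5UpTo t) Γ' ∧ (∀ γ, f γ ∈ Γ → γ ∈ Γ') ∧ Agree q (t - 1) i Γ' w x

/-- The structure of agent `i` read off from `Γ`. It consists of pairs that are possible for
`L i`. A pair may be possible for `N i` as well; as members and non-members are disjoint, it is
then put into the structure or not according to the truth value of the spare proposition `q`. -/
def canonical (q : Φ) (t : ℕ) (i : Agent) (Γ : Set (Formula Φ)) (k : ℕ) : KStruct Φ (k + 1) :=
  ({y | Possible q t i (L i) Γ y.1 y.2 ∧ (q ∈ y.1 ∨ ¬ Possible q t i (N i) Γ y.1 y.2)} :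
    Set (Set Φ × KStruct Φ k))

lemma mem_canonical {q : Φ} {t : ℕ} {i : Agent} {Γ : Set (Formula Φ)} {k : ℕ} {w : Set Φ}
    {x : KStruct Φ k} : (canonical q t i Γ k).Mem w x ↔
      Possible q t i (L i) Γ w x ∧ (q ∈ w ∨ ¬ Possible q t i (N i) Γ w x) := Iff.rfl

lemma Agree.congr {q : Φ} {t : ℕ} {i : Agent} {Γ : Set (Formula Φ)} {k : ℕ} {w w' : Set Φ}
    {x : KStruct Φ k} (hw : AgreeOff q w w') (h : Agree q t i Γ w x) : Agree q t i Γ w' x := by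
  intro β h₁ h₂ h₃ h₄
  rw [h β h₁ h₂ h₃ h₄]
  exact Sim.satAt_iff h₃ (d := 0) (e := KStruct.trivial) (e' := KStruct.trivial) trivial
    (Sim.refl q k le_rfl x) hw (rank_of_objective h₂).le h₄

/-- A pair is impossible for `f` only if `f` rules out one of the formulas that describe it. -/
lemma exists_neg_mem_of_not_possible [Infinite Φ] {q : Φ} {t : ℕ} {i : Agent}
    {f : Formula Φ → Formula Φ} (hf : IsNormal (A5UpTo t) f) {Γ : Set (Formula Φ)}
    (hΓ : IsMCS (A5UpTo t) Γ) {k : ℕ} {w : Set Φ} {x : KStruct Φ k}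
    (h : ¬ Possible q t i f Γ w x) :
    ∃ τ ∈ Lang Φ (t - 1), τ.Objective i ∧ τ.Fresh q ∧ τ.rank i.other ≤ k ∧
      SatAt i τ KStruct.trivial x w ∧ f (neg τ) ∈ Γ := by
  by_contra! hn
  obtain ⟨p, hp⟩ := exists_ne q
  obtain ⟨Γ', hΓ', hs, hT⟩ := hf.exists_successor hΓ
    (T := {τ | τ ∈ Lang Φ (t - 1) ∧ τ.Objective i ∧ τ.Fresh q ∧ τ.rank i.other ≤ k ∧
      SatAt i τ KStruct.trivial x w})
    (by
      by_cases hpw : p ∈ w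
      · exact ⟨atom p, atom_mem_Lang p _, trivial, hp, Nat.zero_le _, by simpa⟩
      · exact ⟨neg (atom p), neg_mem_Lang.2 (atom_mem_Lang p _), trivial, hp, Nat.zero_le _,
          by simpa⟩)
    (by
      rintro α ⟨h₁, h₂, h₃, h₄, h₅⟩ β ⟨h₁', h₂', h₃', h₄', h₅'⟩
      exact ⟨conj α β, ⟨conj_mem_Lang.2 ⟨h₁, h₁'⟩, ⟨h₂, h₂'⟩, ⟨h₃, h₃'⟩, max_le h₄ h₄',
        satAt_conj.2 ⟨h₅, h₅'⟩⟩, .a1 fun v => by simp; tauto, .a1 fun v => by simp⟩)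
    fun τ hτ => hn τ hτ.1 hτ.2.1 hτ.2.2.1 hτ.2.2.2.1 hτ.2.2.2.2
  refine h ⟨Γ', hΓ', hs, fun β h₁ h₂ h₃ h₄ => ?_⟩
  by_cases hβ : SatAt i β KStruct.trivial x w
  · exact iff_of_true (hT ⟨h₁, h₂, h₃, h₄, hβ⟩) hβ
  · exact iff_of_false
      (hΓ'.neg_mem.1 (hT ⟨neg_mem_Lang.2 h₁, h₂, h₃, h₄, satAt_neg.2 hβ⟩)) hβ

/-- Every pair is possible for `L i` or for `N i`. Otherwise `L i (¬ τ)` and `N i (¬ τ)` belong to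
`Γ` for a formula `τ` true of the pair. By soundness of the level below, `τ` is consistent, so this
contradicts `A5`. -/
lemma possible_L_or_N [Infinite Φ] {q : Φ} {t : ℕ} (hS : EventuallySound (Φ := Φ) (A5UpTo t))
    {i : Agent} {Γ : Set (Formula Φ)} (hΓ : IsMCS (A5UpTo (t + 1)) Γ) {k : ℕ} (w : Set Φ)
    (x : KStruct Φ k) :
    Possible q (t + 1) i (L i) Γ w x ∨ Possible q (t + 1) i (N i) Γ w x := by
  by_contra! hn
  obtain ⟨σ, h₁, h₂, h₃, h₄, h₅, h₆⟩ :=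
    exists_neg_mem_of_not_possible (isNormal_L i) hΓ hn.1
  obtain ⟨τ, h₁', h₂', h₃', h₄', h₅', h₆'⟩ :=
    exists_neg_mem_of_not_possible (isNormal_N i) hΓ hn.2
  have hL : L i (neg (conj σ τ)) ∈ Γ :=
    (isNormal_L i).mono_mem hΓ (.a1 fun v => by simp; tauto) h₆
  have hN : N i (neg (conj σ τ)) ∈ Γ :=
    (isNormal_N i).mono_mem hΓ (.a1 fun v => by simp; tauto) h₆'
  have hobj : (conj σ τ).Objective i := ⟨h₂, h₂'⟩
  have hA : A5UpTo (t + 1) i (neg (conj σ τ)) := by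
    refine a5UpTo_succ.2 (.inr ⟨?_, hobj, fun hd => ?_⟩)
    · exact neg_mem_Lang.2 (neg_mem_Lang.2 (conj_mem_Lang.2 ⟨h₁, h₁'⟩))
    · obtain ⟨K, hK⟩ := hS _ hd
      obtain ⟨x', hx'⟩ := exists_sim q k (k' := max k K) le_rfl (le_max_left _ _) x
      -- As `σ` and `τ` are `i`-objective, any structure of agent `i` will do.
      obtain ⟨e, -⟩ := exists_sim q 0 (k' := K) le_rfl (Nat.zero_le _)
        KStruct.trivial
      have h := hK _ _ le_rfl (le_max_right k K) i e x' w
      simp only [satAt_neg, not_not] at h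
      exact h ((Sim.satAt_iff (φ := conj σ τ) (d := 0) (d' := k) ⟨h₃, h₃'⟩ trivial hx' (.refl q w)
        (rank_of_objective hobj).le (max_le h₄ h₄')).1 (satAt_conj.2 ⟨h₅, h₅'⟩))
  exact hΓ.neg_mem.1 (hΓ.imp_mem.1 (hΓ.thm (.a5 hA)) hN) hL

/-- The truth lemma for the canonical structure, for formulas in the scope of an operator of `i`.
The hypothesis `hex` provides the structures of the other agent, which have smaller depth. -/
lemma mem_iff_satAt_canonical {q : Φ} {t : ℕ} {i : Agent} {Γ : Set (Formula Φ)}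
    (hΓ : IsMCS (A5UpTo t) Γ) {k : ℕ}
    (hex : ∀ Γ', IsMCS (A5UpTo t) Γ' →
      ∃ (w : Set Φ) (x : KStruct Φ k), Agree q (t - 1) i Γ' w x)
    (hpos : 1 ≤ t → ∀ (w : Set Φ) (x : KStruct Φ k),
      Possible q t i (L i) Γ w x ∨ Possible q t i (N i) Γ w x)
    {φ : Formula Φ} (hφ : InScope t i φ) (hq : φ.Fresh q) (hi : φ.rank i ≤ k + 1)
    (hj : φ.rank i.other ≤ k) {Γ' : Set (Formula Φ)} (hΓ' : IsMCS (A5UpTo t) Γ')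
    (hsub : ∀ σ : Formula Φ, σ.Subjective i → (σ ∈ Γ' ↔ σ ∈ Γ)) {w : Set Φ} {x : KStruct Φ k}
    (hx : Agree q (t - 1) i Γ' w x) :
    φ ∈ Γ' ↔ SatAt i φ (canonical q t i Γ k) x w := by
  induction φ generalizing Γ' w x with
  | atom p => simpa using hx (atom p) (atom_mem_Lang p _) trivial hq (Nat.zero_le _)
  | neg φ ih => rw [hΓ'.neg_mem, satAt_neg, ih hφ hq hi hj hΓ' hsub hx]
  | disj φ ψ ihφ ihψ =>
    simp only [rank, max_le_iff] at hi hj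
    rw [hΓ'.disj_mem, satAt_disj, ihφ hφ.1 hq.1 hi.1 hj.1 hΓ' hsub hx,
      ihψ hφ.2 hq.2 hi.2 hj.2 hΓ' hsub hx]
  | L j φ ih =>
    by_cases hji : j = i
    · subst hji
      simp only [InScope, if_true] at hφ
      simp only [rank, if_true, max_le_iff, add_le_add_iff_right] at hi
      rw [hsub (L j φ) rfl, satAt_L]
      constructor
      · intro h v y hy
        obtain ⟨Γ₁, h₁, h₂, h₃⟩ := (mem_canonical.1 hy).1
        exact (ih hφ hq hi.1 hi.2 h₁ (fun _ => hΓ.subjective_mem_iff h₁ (.inl h₂)) h₃).1 (h₂ φ h)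
      · intro h
        by_contra hn
        obtain ⟨Γ₁, h₁, h₂, hφ₁⟩ := (isNormal_L j).exists_successor_of_notMem hΓ hn
        obtain ⟨v, y, hy⟩ := hex Γ₁ h₁
        -- A pair with `q` true belongs to the structure even if it is also possible for `N`.
        have hy := hy.congr (agreeOff_insert q v)
        exact hφ₁ ((ih hφ hq hi.1 hi.2 h₁ (fun _ => hΓ.subjective_mem_iff h₁ (.inl h₂)) hy).2
          (h _ _ (mem_canonical.2 ⟨⟨Γ₁, h₁, h₂, hy⟩, .inl (Set.mem_insert q v)⟩)))
    · simp only [InScope, if_neg hji] at hφ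
      rw [hx _ hφ hji hq hj]
      exact satAt_objective (φ := L j φ) hji
  | N j φ ih =>
    by_cases hji : j = i
    · subst hji
      simp only [InScope, if_true] at hφ
      simp only [rank, if_true, max_le_iff, add_le_add_iff_right] at hi
      rw [hsub (N j φ) rfl, satAt_N]
      constructor
      · intro h v y hy
        have hP : Possible q t j (N j) Γ v y := by
          by_contra hP
          exact hy (mem_canonical.2 ⟨(hpos hφ.1 v y).resolve_right hP, .inr hP⟩)
        obtain ⟨Γ₁, h₁, h₂, h₃⟩ := hP
        exact (ih hφ.2 hq hi.1 hi.2 h₁ (fun _ => hΓ.subjective_mem_iff h₁ (.inr h₂)) h₃).1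
          (h₂ φ h)
      · intro h
        by_contra hn
        obtain ⟨Γ₁, h₁, h₂, hφ₁⟩ := (isNormal_N j).exists_successor_of_notMem hΓ hn
        obtain ⟨v, y, hy⟩ := hex Γ₁ h₁
        -- A pair with `q` false that is possible for `N` is outside the structure.
        have hy := hy.congr (agreeOff_diff q v)
        exact hφ₁ ((ih hφ.2 hq hi.1 hi.2 h₁ (fun _ => hΓ.subjective_mem_iff h₁ (.inr h₂)) hy).2
          (h _ _ fun hm => (mem_canonical.1 hm).2.elim (by simp) fun hm =>
            hm ⟨Γ₁, h₁, h₂, hy⟩))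
    · simp only [InScope, if_neg hji] at hφ
      rw [hx _ hφ hji hq hj]
      exact satAt_objective (φ := N j φ) hji

lemma Formula.Subjective.objective_other {i : Agent} {σ : Formula Φ} (h : σ.Subjective i) :
    σ.Objective i.other := by
  induction σ with
  | atom p => exact h.elim
  | neg σ ih => exact ih h
  | disj σ τ ihσ ihτ => exact ⟨ihσ h.1, ihτ h.2⟩
  | L j σ => exact fun hj => Agent.other_ne i (hj.symm.trans h)
  | N j σ => exact fun hj => Agent.other_ne i (hj.symm.trans h)

lemma Formula.Subjective.rank_pos {i : Agent} {σ : Formula Φ} (h : σ.Subjective i) :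
    0 < σ.rank i := by
  induction σ with
  | atom p => exact h.elim
  | neg σ ih => exact ih h
  | disj σ τ ihσ ihτ => exact lt_max_of_lt_left (ihσ h.1)
  | L j σ =>
    obtain rfl : j = i := h
    simp [rank]
  | N j σ =>
    obtain rfl : j = i := h
    simp [rank]

lemma Formula.Subjective.inScope {t : ℕ} {i : Agent} {σ : Formula Φ} (h : σ.Subjective i)
    (hσ : σ ∈ Lang Φ t) : InScope t i σ := by
  induction σ with
  | atom p => exact h.elim
  | neg σ ih => exact ih h (neg_mem_Lang.1 hσ)
  | disj σ τ ihσ ihτ => exact ⟨ihσ h.1 (disj_mem_Lang.1 hσ).1, ihτ h.2 (disj_mem_Lang.1 hσ).2⟩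
  | L j σ =>
    obtain rfl : j = i := h
    simpa [InScope] using inScope_of_mem_Lang.1 hσ
  | N j σ =>
    obtain rfl : j = i := h
    simpa [InScope] using inScope_of_mem_Lang.2 hσ

/-- The structure `e` verifies the same `i`-subjective formulas as `Γ`, among those of `Lang t` in
which `q` does not occur and for which `e` is deep enough. -/
def Realizes (q : Φ) (t : ℕ) (i : Agent) (Γ : Set (Formula Φ)) {k : ℕ} (e : KStruct Φ k) : Prop :=
  ∀ σ ∈ Lang Φ t, σ.Subjective i → σ.Fresh q → σ.rank i ≤ k →
    (σ ∈ Γ ↔ SatAt i σ e KStruct.trivial ∅)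

lemma realizes_trivial (q : Φ) (t : ℕ) (i : Agent) (Γ : Set (Formula Φ)) :
    Realizes q t i Γ KStruct.trivial :=
  fun _ _ hs _ hr => absurd hs.rank_pos hr.not_gt

lemma Realizes.mem_iff_satAt {q : Φ} {t : ℕ} {i : Agent} {A : Agent → Formula Φ → Prop}
    {Γ : Set (Formula Φ)} (hΓ : IsMCS A Γ) {k l : ℕ} {e : KStruct Φ k} {f : KStruct Φ l}
    (he : Realizes q t i Γ e) (hf : Realizes q t i.other Γ f) {φ : Formula Φ}
    (hφ : φ ∈ Lang Φ t) (hq : φ.Fresh q) (hk : φ.rank i ≤ k) (hl : φ.rank i.other ≤ l) :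
    φ ∈ Γ ↔ SatAt i φ e f {p | atom p ∈ Γ} := by
  induction φ with
  | atom p => simp
  | neg φ ih => rw [hΓ.neg_mem, satAt_neg, ih (neg_mem_Lang.1 hφ) hq hk hl]
  | disj φ ψ ihφ ihψ =>
    simp only [rank, max_le_iff] at hk hl
    rw [disj_mem_Lang] at hφ
    rw [hΓ.disj_mem, satAt_disj, ihφ hφ.1 hq.1 hk.1 hl.1, ihψ hφ.2 hq.2 hk.2 hl.2]
  | L j φ =>
    by_cases hj : j = i
    · rw [he _ hφ hj hq hk]
      exact satAt_subjective (σ := L j φ) hj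
    · have hj := Agent.eq_other_of_ne hj
      rw [hf _ hφ hj hq hl, ← satAt_other (i := i)]
      exact satAt_subjective (σ := L j φ) hj
  | N j φ =>
    by_cases hj : j = i
    · rw [he _ hφ hj hq hk]
      exact satAt_subjective (σ := N j φ) hj
    · have hj := Agent.eq_other_of_ne hj
      rw [hf _ hφ hj hq hl, ← satAt_other (i := i)]
      exact satAt_subjective (σ := N j φ) hj

lemma Realizes.agree {q : Φ} {t : ℕ} {i : Agent} {A : Agent → Formula Φ → Prop}
    {Γ : Set (Formula Φ)} (hΓ : IsMCS A Γ) {k : ℕ} {x : KStruct Φ k}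
    (hx : Realizes q t i.other Γ x) : Agree q t i Γ {p | atom p ∈ Γ} x :=
  fun _ h₁ h₂ h₃ h₄ =>
    (realizes_trivial q t i Γ).mem_iff_satAt hΓ hx h₁ h₃ (rank_of_objective h₂).le h₄

/-- Structures of every depth realize a maximal consistent set. The depth decreases at each change
of agent, and with it the level of the language as long as it is positive. -/
lemma exists_realizes [Infinite Φ] (q : Φ) {t : ℕ}
    (hS : ∀ s < t, EventuallySound (Φ := Φ) (A5UpTo s)) {k : ℕ} {i : Agent}
    {Γ : Set (Formula Φ)} (hΓ : IsMCS (A5UpTo t) Γ) : ∃ e : KStruct Φ k, Realizes q t i Γ e := by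
  induction k generalizing t i Γ with
  | zero => exact ⟨_, realizes_trivial q t i Γ⟩
  | succ k ih =>
    have hex : ∀ Γ', IsMCS (A5UpTo t) Γ' →
        ∃ (w : Set Φ) (x : KStruct Φ k), Agree q (t - 1) i Γ' w x := by
      intro Γ' hΓ'
      have h := hΓ'.of_imp (a5UpTo_mono (Nat.sub_le t 1))
      obtain ⟨x, hx⟩ := ih (i := i.other) (fun s hs => hS s (by omega)) h
      exact ⟨_, x, Realizes.agree h hx⟩
    have hpos : 1 ≤ t → ∀ (w : Set Φ) (x : KStruct Φ k),
        Possible q t i (L i) Γ w x ∨ Possible q t i (N i) Γ w x := by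
      intro ht w x
      obtain ⟨s, rfl⟩ := Nat.exists_eq_add_of_le' ht
      exact possible_L_or_N (hS s (by omega)) hΓ w x
    obtain ⟨w, x, hx⟩ := hex Γ hΓ
    refine ⟨canonical q t i Γ k, fun σ hσ hs hq hr => ?_⟩
    rw [mem_iff_satAt_canonical hΓ hex hpos (hs.inScope hσ) hq hr
      (by simp [rank_of_objective hs.objective_other]) hΓ (fun _ _ => Iff.rfl) hx]
    exact satAt_subjective hs

/-- A consistent formula is satisfiable at every depth that suffices for its evaluation. -/
lemma exists_satAt_of_consistent [Infinite Φ] {t : ℕ}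
    (hS : ∀ s < t, EventuallySound (Φ := Φ) (A5UpTo s)) {φ : Formula Φ} (hφ : φ ∈ Lang Φ t)
    (hcon : ¬ Deriv (A5UpTo t) (neg φ)) (i : Agent) {k l : ℕ} (hk : φ.rank i ≤ k)
    (hl : φ.rank i.other ≤ l) :
    ∃ (e : KStruct Φ k) (f : KStruct Φ l) (w : Set Φ), SatAt i φ e f w := by
  obtain ⟨q, hq⟩ := exists_fresh φ
  obtain ⟨Γ, hΓ, hm⟩ := exists_isMCS_of_irrefutable hcon
  obtain ⟨e, he⟩ := exists_realizes q hS (k := k) (i := i) hΓ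
  obtain ⟨f, hf⟩ := exists_realizes q hS (k := l) (i := i.other) hΓ
  exact ⟨e, f, _, (he.mem_iff_satAt hΓ hf hφ hq hk hl).1 hm⟩

/-! ### Soundness at large depths -/

lemma propEval_satAt {i : Agent} {k l : ℕ} {e : KStruct Φ k} {f : KStruct Φ l} {w : Set Φ}
    (φ : Formula Φ) : φ.PropEval (fun x => SatAt i x e f w) ↔ SatAt i φ e f w := by
  induction φ with
  | neg φ ih => rw [propEval_neg, ih, satAt_neg]
  | disj φ ψ ihφ ihψ => rw [propEval_disj, ihφ, ihψ, satAt_disj]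
  | _ => rfl

lemma exists_level_of_a5UpTo {t : ℕ} {i : Agent} {α : Formula Φ} (h : A5UpTo t i α) :
    ∃ s < t, neg α ∈ Lang Φ s ∧ (neg α).Objective i ∧
      ¬ Deriv (A5UpTo s) (neg (neg α)) := by
  induction t with
  | zero => exact h.elim
  | succ t ih =>
    rcases a5UpTo_succ.1 h with h | h
    · obtain ⟨s, hs, h⟩ := ih h
      exact ⟨s, hs.trans t.lt_succ_self, h⟩
    · exact ⟨t, t.lt_succ_self, h⟩

/-- Truth at all large depths may be checked from the point of view of any one agent `j`. -/
lemma exists_forall_satAt_of_agent {φ : Formula Φ} (j : Agent) (K : ℕ)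
    (h : ∀ k l, K ≤ k → K ≤ l → ∀ (e : KStruct Φ (k + 1)) (f : KStruct Φ l) (w : Set Φ),
      SatAt j φ e f w) :
    ∃ K, ∀ k l, K ≤ k → K ≤ l → ∀ (i : Agent) (e : KStruct Φ k) (f : KStruct Φ l)
      (w : Set Φ), SatAt i φ e f w := by
  have h' : ∀ k l, K + 1 ≤ k → K + 1 ≤ l → ∀ (e : KStruct Φ k) (f : KStruct Φ l) (w : Set Φ),
      SatAt j φ e f w := by
    intro k l hk hl e f w
    match k, e, hk with
    | k + 1, e, hk => exact h k l (by omega) (by omega) e f w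
  refine ⟨K + 1, fun k l hk hl i e f w => ?_⟩
  by_cases hi : i = j
  · exact hi ▸ h' k l hk hl e f w
  · obtain rfl := Agent.eq_other_of_ne hi
    exact satAt_other.2 (h' l k hl hk f e w)

/-- An instance of `A5` is sound because the formula in question is satisfiable at every large
depth, whence no structure together with its complement can miss the pairs that satisfy it. -/
theorem eventuallySound_a5UpTo [Infinite Φ] (t : ℕ) : EventuallySound (Φ := Φ) (A5UpTo t) := by
  induction t using Nat.strong_induction_on with
  | _ t IH =>
  intro φ hφ
  induction hφ with
  | a1 h => exact ⟨0, fun _ _ _ _ i e f w => (propEval_satAt _).1 (h _)⟩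
  | a2 j α β =>
    refine exists_forall_satAt_of_agent j 0 fun k l _ _ e f w => ?_
    simp only [satAt_imp, satAt_L]
    exact fun h₁ h₂ v x hx => h₁ v x hx (h₂ v x hx)
  | a3 j α β =>
    refine exists_forall_satAt_of_agent j 0 fun k l _ _ e f w => ?_
    simp only [satAt_imp, satAt_N]
    exact fun h₁ h₂ v x hx => h₁ v x hx (h₂ v x hx)
  | a4 j h =>
    refine exists_forall_satAt_of_agent j 0 fun k l _ _ e f w => ?_
    simp only [satAt_imp, satAt_conj, satAt_L, satAt_N]
    exact fun hs => ⟨fun _ _ _ => (satAt_subjective h).1 hs, fun _ _ _ => (satAt_subjective h).1 hs⟩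
  | @a5 j α h =>
    obtain ⟨s, hs, h₁, h₂, h₃⟩ := exists_level_of_a5UpTo h
    refine exists_forall_satAt_of_agent j (α.rank j.other) fun k l hk _ e f w => ?_
    obtain ⟨e', x, v, hx⟩ := exists_satAt_of_consistent (fun r hr => IH r (hr.trans hs)) h₁ h₃ j
      (k := 0) (l := k) (rank_of_objective h₂).le hk
    have hx : ¬ SatAt j α e x v := satAt_neg.1 ((satAt_objective h₂).1 hx)
    simp only [satAt_imp, satAt_neg, satAt_L, satAt_N]
    intro hN hL
    by_cases hm : e.Mem v x
    · exact hx (hL v x hm)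
    · exact hx (hN v x hm)
  | mp _ _ ih₁ ih₂ =>
    obtain ⟨K, hK⟩ := ih₁
    obtain ⟨K', hK'⟩ := ih₂
    refine ⟨max K K', fun k l hk hl i e f w => ?_⟩
    rw [max_le_iff] at hk hl
    exact satAt_imp.1 (hK k l hk.1 hl.1 i e f w) (hK' k l hk.2 hl.2 i e f w)
  | necL j _ ih =>
    obtain ⟨K, hK⟩ := ih
    refine exists_forall_satAt_of_agent j K fun k l hk _ e f w => satAt_L.2 fun v x _ => ?_
    exact hK _ _ (by omega) hk j e x v
  | necN j _ ih =>
    obtain ⟨K, hK⟩ := ih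
    refine exists_forall_satAt_of_agent j K fun k l hk _ e f w => satAt_N.2 fun v x _ => ?_
    exact hK _ _ (by omega) hk j e x v

end OnlyKnowing

theorem mainTheorem1 {Φ : Type u} [Infinite Φ] (t : ℕ) (ht : 1 ≤ t)
    (α : OnlyKnowing.Formula Φ) (hα : α ∈ OnlyKnowing.ONL Φ t)
    (hvalid : OnlyKnowing.Valid α) : OnlyKnowing.AX t α := by
  obtain ⟨s, rfl⟩ := Nat.exists_eq_add_of_le' ht
  by_contra hn
  obtain ⟨e, f, w, h⟩ := OnlyKnowing.exists_satAt_of_consistent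
    (fun r _ => OnlyKnowing.eventuallySound_a5UpTo r)
    (OnlyKnowing.neg_mem_Lang (t := s + 1) |>.2 hα)
    (fun hd => hn (.of_entails [_] (by simpa using hd) fun v hv => by simpa using hv)) .a
    (α.rank_le_depth .a).1 (α.rank_le_depth .b).1
  exact OnlyKnowing.satAt_neg.1 h (hvalid e f w)
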